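/- Let $k$ be a field of characteristic zero and let $A$ be a unital associative (not necessarily commutative) $k$-algebra. Let $L=\mathfrak{sl}_4(A)=[\mathfrak{gl}_4(A),\mathfrak{gl}_4(A)]$ be the derived Lie algebra of $\mathfrak{gl}_4(A)=\mathrm{Mat}_4(A)^-$, let $E_{pq}(a)=aE_{pq}$, and let $\mathfrak h$ be the space of traceless diagonal matrices with entries in $k$, viewed in $L$. For $1\le p\le 4$ let $\varepsilon_p\in\mathfrak h^*$ be the projection onto the $p$-th diagonal entry. For $p\neq q$ put $L_{\varepsilon_p-\varepsilon_q}=E_{pq}(A)$, let $L_0$ be the subalgebra of diagonal matrices in $L$ and $L_+$ (resp. $L_-$) the subalgebra of strictly upper (resp. lower) triangular matrices in $L$. For $i\in\{1,2,3\}$ let $\alpha_i=\varepsilon_i-\varepsilon_{i+1}$, let $\varpi_i$ be the corresponding fundamental weights, and put $h_i(a)=a(E_{ii}-E_{i+1,i+1})\in L_0$ for $a\in A$. Let $U(L)_0$ be the centralizer of $\mathfrak h$ in the universal enveloping algebra $U(L)$. Then $U(L)_0=U(L_0)\oplus K$, where $K=U(L)L_+\cap U(L)_0=L_-U(L)\cap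 U(L)_0$ is a two-sided ideal of $U(L)_0$; let $\pi_0\colon U(L)_0\to U(L_0)$ be the projection with kernel $K$ (the Harish-Chandra homomorphism). For $\lambda=\ell_1\varpi_1+\ell_2\varpi_2+\ell_3\varpi_3$ with $\ell_i\in\mathbb N$, let $J^\lambda$ be the two-sided ideal of $U(L_0)$ generated by the following elements, for $i\in\{1,2,3\}$: (i) $\pi_0(x_1\cdots x_m\,y_1\cdots y_{\ell_i+1})$ for all finite sequences with $x_j\in L_{\beta_j}$, $\beta_j\in\{\varepsilon_p-\varepsilon_q: p<q\}$, $y_j\in L_{-\alpha_i}$ and $\sum_{j=1}^m\beta_j=(\ell_i+1)\alpha_i$; (ii) $h_i(1_A)-\ell_i 1$. Let $S^\lambda=U(L_0)/J^\lambda$ (the Seligman algebra of $(\mathfrak{sl}_4(A),\mathfrak{sl}_4(k))$). Suppose that $\lambda=\varpi_1+\varpi_2$. (a) If $A$ is a generalized quaternion algebra over $k$, i.e. the $k$-algebra with generators $\mathbf i,\mathbf j$ and relations $\mathbf i^2=a$, $\mathbf j^2=b$, $\mathbf i\mathbf j=-\mathbf j\mathbf i$ for some $a,b\in k^\times$, then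 the map $A\to S^\lambda$, $a\mapsto h_2(a)+J^\lambda$, is an isomorphism of unital associative $k$-algebras. (b) If $A=\mathrm{Mat}_{2n}(k)$ with $n\ge 2$, then $S^\lambda=\{0\}$. -/

import Mathlib

attribute [local instance 100] LieRing.ofAssociativeRing

open UniversalEnvelopingAlgebra

universe u v

noncomputable section

namespace SlA

section LieAlgebra

variable (k : Type u) [Field k] (A : Type v) [Ring A] [Algebra k A] (r : ℕ)

/-- The Lie algebra `gl_{r+1}(A)` of all square matrices of size `r + 1` over the associative
algebra `A`, with the commutator bracket. -/
abbrev Gl : Type v := Matrix (Fin (r + 1)) (Fin (r + 1)) A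

/-- `L = sl_{r+1}(A) = [gl_{r+1}(A), gl_{r+1}(A)]`, the derived algebra of `gl_{r+1}(A)`. -/
def sl : LieSubalgebra k (Gl A r) :=
  (⁅(⊤ : LieIdeal k (Gl A r)), (⊤ : LieIdeal k (Gl A r))⁆ : LieIdeal k (Gl A r)).toLieSubalgebra

/-- The commutator of two matrices, as an element of `sl_{r+1}(A)`. -/
theorem lie_mem_sl (x y : Gl A r) : ⁅x, y⁆ ∈ sl k A r :=
  LieSubmodule.lie_mem_lie (LieSubmodule.mem_top x) (LieSubmodule.mem_top y)

variable {A r} in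
theorem single_mem_sl {p q : Fin (r + 1)} (hpq : p ≠ q) (a : A) :
    Matrix.single p q a ∈ sl k A r := by
  have h : ⁅(Matrix.single p p (1 : A) : Gl A r), (Matrix.single p q a : Gl A r)⁆
      = Matrix.single p q a := by
    rw [LieRing.of_associative_ring_bracket, Matrix.single_mul_single_same,
      Matrix.single_mul_single_of_ne _ _ _ _ hpq.symm, one_mul, sub_zero]
  exact h ▸ lie_mem_sl k A r _ _

variable {A r} in
/-- The off-diagonal elementary matrix `E_{pq}(a) = a E_{pq}`, `p ≠ q`, of `sl_{r+1}(A)`. -/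
def E {p q : Fin (r + 1)} (hpq : p ≠ q) (a : A) : sl k A r :=
  ⟨Matrix.single p q a, single_mem_sl k hpq a⟩

variable {A r} in
/-- `e_i(a) = E_{i,i+1}(a)`. The simple roots are indexed by `i : Fin r`, starting from `0`. -/
def e (i : Fin r) (a : A) : sl k A r :=
  E k (p := i.castSucc) (q := i.succ) (Fin.castSucc_lt_succ (i := i)).ne a

variable {A r} in
/-- `f_i(a) = E_{i+1,i}(a)`. -/
def f (i : Fin r) (a : A) : sl k A r :=
  E k (p := i.succ) (q := i.castSucc) (Fin.castSucc_lt_succ (i := i)).ne' a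

/-- `L_0`, the subalgebra of diagonal matrices in `sl_{r+1}(A)`. -/
def L0 : LieSubalgebra k (sl k A r) where
  carrier := {x | (x : Gl A r).IsDiag}
  add_mem' := fun {x y} hx hy => Matrix.IsDiag.add hx hy
  zero_mem' := Matrix.isDiag_zero
  smul_mem' := fun c _ hx => Matrix.IsDiag.smul c hx
  lie_mem' := fun {x y} hx hy => by
    change (⁅(x : Gl A r), (y : Gl A r)⁆).IsDiag
    rw [LieRing.of_associative_ring_bracket, ← Matrix.IsDiag.diagonal_diag hx,
      ← Matrix.IsDiag.diagonal_diag hy, Matrix.diagonal_mul_diagonal,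
      Matrix.diagonal_mul_diagonal, Matrix.diagonal_sub]
    exact Matrix.isDiag_diagonal _

variable {A r} in
theorem lie_e_f_mem (i : Fin r) (a b : A) : ⁅e k i a, f k i b⁆ ∈ L0 k A r := by
  change (⁅(Matrix.single i.castSucc i.succ a : Gl A r),
    (Matrix.single i.succ i.castSucc b : Gl A r)⁆).IsDiag
  rw [LieRing.of_associative_ring_bracket, Matrix.single_mul_single_same,
    Matrix.single_mul_single_same]
  intro p q hpq
  rw [Matrix.sub_apply, Matrix.single_apply_of_ne, Matrix.single_apply_of_ne, sub_zero]
  · rintro ⟨rfl, rfl⟩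
    exact hpq rfl
  · rintro ⟨rfl, rfl⟩
    exact hpq rfl

variable {A r} in
/-- `H_i(a,b) = [e_i(a), f_i(b)] = ab E_{i,i} - ba E_{i+1,i+1}`. -/
def H (i : Fin r) (a b : A) : L0 k A r := ⟨⁅e k i a, f k i b⁆, lie_e_f_mem k i a b⟩

variable {A r} in
/-- `h_i(a) = H_i(a,1) = a (E_{i,i} - E_{i+1,i+1})`. -/
def h (i : Fin r) (a : A) : L0 k A r := H k i a 1

/-- The splitting Cartan subalgebra `𝔥` of `𝔤 = sl_{r+1}(k)`, as a subset of `L`: the traceless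
diagonal matrices with entries in `k`. -/
def cartan : Set (sl k A r) :=
  {x | ∃ d : Fin (r + 1) → k, ∑ p, d p = 0 ∧
    (x : Gl A r) = Matrix.diagonal fun p => algebraMap k A (d p)}

/-- The root `ε_p - ε_q`. An element of the root lattice is represented by its integer
coordinates in `ε_0, …, ε_r`; these sum to zero, so it is determined by its restriction to the
traceless diagonal matrices. -/
def root (p q : Fin (r + 1)) : Fin (r + 1) → ℤ := Pi.single p 1 - Pi.single q 1

variable {r} in
/-- The root space `L_{ε_p - ε_q} = E_{pq}(A)`, for `p ≠ q`. -/
def rootSpace (p q : Fin (r + 1)) : Set (sl k A r) :=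
  {x | ∃ a : A, (x : Gl A r) = Matrix.single p q a}

/-- `L_+`, the strictly upper triangular matrices of `L`. -/
def Lplus : Set (sl k A r) := {x | ∀ p q : Fin (r + 1), q ≤ p → (x : Gl A r) p q = 0}

/-- `U(L)`. -/
abbrev U : Type (max u v) := UniversalEnvelopingAlgebra k (sl k A r)

/-- `U(L_0)`. -/
abbrev U0 : Type (max u v) := UniversalEnvelopingAlgebra k (L0 k A r)

/-- The canonical algebra homomorphism `U(L_0) → U(L)` induced by the inclusion `L_0 ⊆ L`
(injective, by the Poincaré–Birkhoff–Witt theorem). -/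
def incl : U0 k A r →ₐ[k] U k A r := lift k ((ι k).comp (L0 k A r).incl)

/-- `U(L)_0`, the zero weight space of `U(L)` under the adjoint action of `𝔥`: the elements that
commute with `𝔥`. -/
def weightZero : Subalgebra k (U k A r) := Subalgebra.centralizer k (ι k '' cartan k A r)

/-- `K = U(L) L_+ ∩ U(L)_0`. -/
def hcKernel : Submodule k (U k A r) :=
  (Submodule.span (U k A r) (ι k '' Lplus k A r)).restrictScalars k ⊓
    Subalgebra.toSubmodule (weightZero k A r)

/-- `IsHC z w` says that `π₀ z = w`, where `π₀ : U(L)_0 → U(L_0)` is the Harish-Chandra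
homomorphism, i.e. the projection onto the first summand of `U(L)_0 = U(L_0) ⊕ K`: the element
`z` of `U(L)_0` differs from `w` by an element of `K`. By the Poincaré–Birkhoff–Witt theorem,
each `z ∈ U(L)_0` has exactly one such `w`. -/
def IsHC (z : U k A r) (w : U0 k A r) : Prop :=
  z ∈ weightZero k A r ∧ z - incl k A r w ∈ hcKernel k A r

variable {r}

/-- The elements `π₀(x_1 ⋯ x_m y_1 ⋯ y_{ℓ+1})` with `ℓ = lam i`, `x_j ∈ L_{β_j}` for positive roots
`β_j = ε_{p_j} - ε_{q_j}` (`p_j < q_j`), `y_j ∈ L_{-α_i}`, and `β_1 + ⋯ + β_m = (ℓ + 1) α_i`, where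
`α_i = ε_i - ε_{i+1}`. -/
def hcGenerators (lam : Fin r → ℕ) (i : Fin r) : Set (U0 k A r) :=
  {w | ∃ (m : ℕ) (p q : Fin m → Fin (r + 1)) (x : Fin m → sl k A r)
      (y : Fin (lam i + 1) → sl k A r),
    (∀ j, p j < q j) ∧ (∀ j, x j ∈ rootSpace k A (p j) (q j)) ∧
    (∀ j, y j ∈ rootSpace k A i.succ i.castSucc) ∧
    ∑ j, root r (p j) (q j) = (lam i + 1) • root r i.castSucc i.succ ∧
    IsHC k A r
      ((List.ofFn fun j => ι k (x j)).prod * (List.ofFn fun j => ι k (y j)).prod) w}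

/-- The ideal `J^λ` of `U(L_0)`, for the dominant integral weight `λ = ∑ i, lam i • ϖ_i`. -/
def J (lam : Fin r → ℕ) : TwoSidedIdeal (U0 k A r) :=
  TwoSidedIdeal.span
    (⋃ i, (hcGenerators k A lam i ∪ {ι k (h k i (1 : A)) - (lam i : U0 k A r)}))

/-- The Seligman algebra `S^λ = U(L_0) / J^λ` of `(sl_{r+1}(A), sl_{r+1}(k))`. -/
abbrev Seligman (lam : Fin r → ℕ) : Type (max u v) := (J k A lam).ringCon.Quotient

/-- The canonical map `u ↦ u + J^λ`. -/
def can (lam : Fin r → ℕ) : U0 k A r →ₐ[k] Seligman k A lam := (J k A lam).ringCon.mkₐ k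

end LieAlgebra

/-- `A` is a generalized quaternion algebra over `k`: the `k`-algebra with generators `i`, `j` and
relations `i² = a`, `j² = b`, `ij = -ji`, for some non-zero `a, b ∈ k`. -/
def IsGeneralizedQuaternion (k : Type u) [Field k] (A : Type v) [Ring A] [Algebra k A] : Prop :=
  ∃ a b : k, a ≠ 0 ∧ b ≠ 0 ∧ Nonempty (A ≃ₐ[k] QuaternionAlgebra k a 0 b)

end SlA

end

/-! Write τ and ρ for the maps a ↦ h_1(a), a ↦ h_2(a) into S^λ (`hOne`, `hTwo`). Straightening e·f
and e·e·f·f makes the generators of J^λ explicit (`isHC_e_f`, `isHC_e_e_f_f`). They give H_3(a,b) =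
0 and, for i = 1, 2, h_i(a)h_i(b) = H_i(a,b) in S^λ. Consequently ρ is an algebra homomorphism,
τ(a)τ(b) = τ(ab) + ρ([a,b]), the elements τ(a) + ρ(a) commute with ρ(A), and τ, ρ generate S^λ
(`can₀_eq`).

Associativity of τ(a)τ(b)τ(a) then forces (τ+ρ)(a)·ρ([b,a]) = ρ([b,a²]) (`add_mul_commutator`),
which settles both cases. For matrices of size at least 3, τ+ρ equals 1 at E_ii, at E_jj and at
their sum, so 1 + 1 = 1 and S^λ = 0. For quaternions, a pure basis element has central square and an
invertible commutator with another one, so τ+ρ vanishes on it, while (τ+ρ)(1) = 2. Hence τ takes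
values in ρ(A), and ρ is onto.

Injectivity of ρ follows from simplicity of A once S^λ ≠ 0. For this, A is split over the algebraic
closure K of k, and sl_4(A) acts on alternating 3-tensors of K^4 ⊗ K^2. The space of weight 2ε_1 +
ε_2 is non-zero, stable under U(L_0), and killed by J^λ (`nontrivial_of_algHom`). -/

namespace SlA

/-! ### Commutation identities in an associative ring -/

section Straightening

variable {R : Type*} [Ring R]

/-- Straightening of a product of two raising and two lowering operators. -/
theorem straighten {ea eb fc fd hac hbd hbc had e₁ e₂ h₁ : R}
    (hac' : ea * fc = fc * ea + hac) (hbd' : eb * fd = fd * eb + hbd)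
    (hbc' : eb * fc = fc * eb + hbc) (had' : ea * fd = fd * ea + had)
    (he₁ : ea * hbc = hbc * ea - e₁) (he₂ : ea * hbd = hbd * ea - e₂)
    (hh₁ : e₁ * fd = fd * e₁ + h₁) :
    ea * eb * (fc * fd) - (hac * hbd + hbc * had - h₁) =
      (fc * ea * fd + hac * fd) * eb + (fc * hbd + hbc * fd) * ea - fc * e₂ - fd * e₁ := by
  have h1 : ea * eb * (fc * fd) = (ea * fc) * (eb * fd) + (ea * hbc) * fd := by
    calc ea * eb * (fc * fd) = ea * (eb * fc) * fd := by simp only [mul_assoc]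
      _ = _ := by rw [hbc']; noncomm_ring
  have h2 : (ea * fc) * (eb * fd) =
      fc * ea * fd * eb + fc * (ea * hbd) + hac * fd * eb + hac * hbd := by
    rw [hac', hbd']; noncomm_ring
  have h3 : (ea * hbc) * fd = hbc * (ea * fd) - e₁ * fd := by
    rw [he₁]; noncomm_ring
  rw [h1, h2, h3, had', hh₁, he₂]
  noncomm_ring

theorem commute_of_weights {k : Type*} [Field k] [Algebra k R] {x e e' f f' : R} {c : k}
    (he : x * e = e * x + c • e) (he' : x * e' = e' * x + c • e')
    (hf : x * f = f * x - c • f) (hf' : x * f' = f' * x - c • f') :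
    x * (e * e' * (f * f')) = e * e' * (f * f') * x := by
  calc x * (e * e' * (f * f')) = (x * e) * e' * f * f' := by simp only [mul_assoc]
    _ = e * (x * e') * f * f' + c • (e * e' * f * f') := by
      rw [he]; simp only [add_mul, mul_assoc, smul_mul_assoc]
    _ = e * e' * (x * f) * f' + c • (e * e' * f * f') + c • (e * e' * f * f') := by
      rw [he']; simp only [add_mul, mul_add, mul_assoc, smul_mul_assoc, mul_smul_comm]
    _ = e * e' * f * (x * f') + c • (e * e' * f * f') := by
      rw [hf]
      simp only [sub_mul, mul_sub, mul_assoc, smul_mul_assoc, mul_smul_comm]; abel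
    _ = e * e' * (f * f') * x := by
      rw [hf']
      simp only [mul_sub, mul_assoc, mul_smul_comm]; abel

theorem commute_of_weights₂ {k : Type*} [Field k] [Algebra k R] {x e f : R} {c : k}
    (he : x * e = e * x + c • e) (hf : x * f = f * x - c • f) :
    x * (e * f) = e * f * x := by
  calc x * (e * f) = (x * e) * f := by simp only [mul_assoc]
    _ = e * (x * f) + c • (e * f) := by
      rw [he]; simp only [add_mul, mul_assoc, smul_mul_assoc]
    _ = e * f * x := by
      rw [hf]
      simp only [mul_sub, mul_assoc, mul_smul_comm]; abel

end Straightening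

/-! ### Harish-Chandra images and the resulting relations in S^λ -/

section HarishChandra

variable {k : Type u} [Field k] {A : Type v} [Ring A] [Algebra k A] {r : ℕ}

theorem diagonal_mul_single' {n : Type*} [Fintype n] [DecidableEq n] (d : n → A) (p q : n) (a : A) :
    Matrix.diagonal d * Matrix.single p q a = Matrix.single p q (d p * a) := by
  ext i j
  by_cases hi : p = i <;> simp [Matrix.diagonal_mul, Matrix.single_apply, hi]

theorem single_mul_diagonal' {n : Type*} [Fintype n] [DecidableEq n] (d : n → A) (p q : n) (a : A) :
    Matrix.single p q a * Matrix.diagonal d = Matrix.single p q (a * d q) := by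
  ext i j
  by_cases hj : q = j <;> simp [Matrix.mul_diagonal, Matrix.single_apply, hj]

/-- An enveloping algebra is generated by its Lie algebra: the restriction of `φ` corestricts to
`S`, and its lift followed by `S.val` is `φ` by uniqueness. -/
theorem map_mem_of_map_ι_mem {𝔩 : Type*} [LieRing 𝔩] [LieAlgebra k 𝔩] {B : Type*} [Ring B]
    [Algebra k B] (S : Subalgebra k B) (φ : UniversalEnvelopingAlgebra k 𝔩 →ₐ[k] B)
    (hφ : ∀ x, φ (ι k x) ∈ S) (w : UniversalEnvelopingAlgebra k 𝔩) : φ w ∈ S := by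
  let g : 𝔩 →ₗ⁅k⁆ S :=
    { toLinearMap := (φ.toLinearMap ∘ₗ (ι k : 𝔩 →ₗ⁅k⁆ _).toLinearMap).codRestrict
        (Subalgebra.toSubmodule S) hφ
      map_lie' := fun {x y} => by
        apply Subtype.ext
        change φ (ι k ⁅x, y⁆) = φ (ι k x) * φ (ι k y) - φ (ι k y) * φ (ι k x)
        rw [LieHom.map_lie, LieRing.of_associative_ring_bracket, map_sub, map_mul, map_mul] }
  have h : S.val.comp (lift k g) = φ := by
    apply UniversalEnvelopingAlgebra.hom_ext
    ext x
    change ((lift k g (ι k x) : S) : B) = φ (ι k x)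
    rw [lift_ι_apply]
    rfl
  rw [← h]
  exact (lift k g w).2

theorem ι_mul (x y : sl k A r) : ι k x * ι k y = ι k y * ι k x + ι k ⁅x, y⁆ := by
  rw [LieHom.map_lie, LieRing.of_associative_ring_bracket]; abel

theorem lie_e_H (i : Fin r) (a b c : A) :
    ⁅e k i a, (H k i b c : sl k A r)⁆ = - e k i (b * c * a + a * c * b) := by
  have hne : i.castSucc ≠ i.succ := (Fin.castSucc_lt_succ (i := i)).ne
  apply Subtype.ext
  change (⁅(Matrix.single i.castSucc i.succ a : Gl A r),
    ⁅(Matrix.single i.castSucc i.succ b : Gl A r),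
     (Matrix.single i.succ i.castSucc c : Gl A r)⁆⁆) =
     -(Matrix.single i.castSucc i.succ (b * c * a + a * c * b) : Gl A r)
  simp only [LieRing.of_associative_ring_bracket, Matrix.single_mul_single_same, mul_sub, sub_mul,
    Matrix.single_mul_single_of_ne _ _ _ _ hne.symm,
    Matrix.single_add, zero_sub, sub_zero, mul_assoc]
  abel

theorem incl_ι (x : L0 k A r) : incl k A r (ι k x) = ι k (x : sl k A r) := by
  simp [incl]

theorem e_mem_Lplus (i : Fin r) (a : A) : e k i a ∈ Lplus k A r := by
  intro p q hqp
  change Matrix.single i.castSucc i.succ a p q = 0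
  apply Matrix.single_apply_of_ne
  rintro ⟨rfl, rfl⟩
  exact absurd hqp (not_le.2 (Fin.castSucc_lt_succ (i := i)))

theorem cartan_mul_e {x : sl k A r} {d : Fin (r + 1) → k}
    (hx : (x : Gl A r) = Matrix.diagonal fun p => algebraMap k A (d p)) (i : Fin r) (a : A) :
    ι k x * ι k (e k i a) = ι k (e k i a) * ι k x +
      (d i.castSucc - d i.succ) • ι k (e k i a) := by
  rw [ι_mul, ← map_smul]
  congr 2
  apply Subtype.ext
  change ⁅(x : Gl A r), (Matrix.single i.castSucc i.succ a : Gl A r)⁆ =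
    (d i.castSucc - d i.succ) • (Matrix.single i.castSucc i.succ a : Gl A r)
  rw [hx, LieRing.of_associative_ring_bracket, diagonal_mul_single',
    single_mul_diagonal', ← Algebra.commutes, ← Algebra.smul_def, ← Algebra.smul_def,
    ← Matrix.smul_single, ← Matrix.smul_single, sub_smul]

theorem cartan_mul_f {x : sl k A r} {d : Fin (r + 1) → k}
    (hx : (x : Gl A r) = Matrix.diagonal fun p => algebraMap k A (d p)) (i : Fin r) (a : A) :
    ι k x * ι k (f k i a) = ι k (f k i a) * ι k x -
      (d i.castSucc - d i.succ) • ι k (f k i a) := by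
  rw [ι_mul, ← map_smul, sub_eq_add_neg, ← map_neg]
  congr 2
  apply Subtype.ext
  change ⁅(x : Gl A r), (Matrix.single i.succ i.castSucc a : Gl A r)⁆ =
    -((d i.castSucc - d i.succ) • (Matrix.single i.succ i.castSucc a : Gl A r))
  rw [hx, LieRing.of_associative_ring_bracket, diagonal_mul_single',
    single_mul_diagonal', ← Algebra.commutes, ← Algebra.smul_def, ← Algebra.smul_def,
    ← Matrix.smul_single, ← Matrix.smul_single, sub_smul, neg_sub]

theorem mul_mem_span_Lplus (z : U k A r) (i : Fin r) (a : A) :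
    z * ι k (e k i a) ∈ Submodule.span (U k A r) (ι k '' Lplus k A r) :=
  Submodule.smul_mem _ z (Submodule.subset_span ⟨_, e_mem_Lplus i a, rfl⟩)

theorem e_mul_f (i : Fin r) (a b : A) :
    ι k (e k i a) * ι k (f k i b) = ι k (f k i b) * ι k (e k i a) + incl k A r (ι k (H k i a b)) := by
  rw [ι_mul, incl_ι]; rfl

theorem e_mul_H (i : Fin r) (a b c : A) :
    ι k (e k i a) * incl k A r (ι k (H k i b c)) =
      incl k A r (ι k (H k i b c)) * ι k (e k i a) - ι k (e k i (b * c * a + a * c * b)) := by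
  rw [incl_ι, ι_mul, lie_e_H, map_neg, sub_eq_add_neg]

theorem incl_mem_weightZero (w : U0 k A r) : incl k A r w ∈ weightZero k A r := by
  refine map_mem_of_map_ι_mem (weightZero k A r) (incl k A r) (fun y => ?_) w
  rw [incl_ι, weightZero, Subalgebra.mem_centralizer_iff]
  rintro _ ⟨x, ⟨d, -, hd⟩, rfl⟩
  rw [ι_mul]
  have : ⁅x, (y : sl k A r)⁆ = 0 := by
    apply Subtype.ext
    change ⁅(x : Gl A r), ((y : sl k A r) : Gl A r)⁆ = 0
    rw [hd, ← Matrix.IsDiag.diagonal_diag y.2, LieRing.of_associative_ring_bracket,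
      Matrix.diagonal_mul_diagonal, Matrix.diagonal_mul_diagonal, sub_eq_zero]
    congr 1; ext p; exact Algebra.commutes _ _
  rw [this, map_zero, add_zero]

theorem isHC_e_f (i : Fin r) (a b : A) :
    IsHC k A r (ι k (e k i a) * ι k (f k i b)) (ι k (H k i a b)) := by
  have hw : ι k (e k i a) * ι k (f k i b) ∈ weightZero k A r := by
    rw [weightZero, Subalgebra.mem_centralizer_iff]
    rintro _ ⟨x, ⟨d, -, hd⟩, rfl⟩
    exact commute_of_weights₂ (cartan_mul_e hd i a) (cartan_mul_f hd i b)
  refine ⟨hw, ?_, sub_mem hw (incl_mem_weightZero _)⟩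
  rw [e_mul_f, add_sub_cancel_right]
  exact mul_mem_span_Lplus _ i a

/-- Each e-factor is moved to the right; every leftover term ends in some e_i and so lies in
U(L)L_+. The correction term comes from [e_i(a), H_i(b,c)], which is again of the form e_i. -/
theorem isHC_e_e_f_f (i : Fin r) (a b c d : A) :
    IsHC k A r (ι k (e k i a) * ι k (e k i b) * (ι k (f k i c) * ι k (f k i d)))
      (ι k (H k i a c) * ι k (H k i b d) + ι k (H k i b c) * ι k (H k i a d) -
        ι k (H k i (b * c * a + a * c * b) d)) := by
  have hw : ι k (e k i a) * ι k (e k i b) * (ι k (f k i c) * ι k (f k i d)) ∈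
      weightZero k A r := by
    rw [weightZero, Subalgebra.mem_centralizer_iff]
    rintro _ ⟨x, ⟨d, -, hd⟩, rfl⟩
    exact commute_of_weights (cartan_mul_e hd i a) (cartan_mul_e hd i b)
      (cartan_mul_f hd i c) (cartan_mul_f hd i _)
  refine ⟨hw, ?_, sub_mem hw (incl_mem_weightZero _)⟩
  rw [map_sub, map_add, map_mul, map_mul,
    straighten (e_mul_f i a c) (e_mul_f i b d) (e_mul_f i b c) (e_mul_f i a d)
      (e_mul_H i a b c) (e_mul_H i a b d) (e_mul_f i _ d)]
  exact sub_mem (sub_mem (add_mem (mul_mem_span_Lplus _ i b) (mul_mem_span_Lplus _ i a))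
    (mul_mem_span_Lplus _ i _)) (mul_mem_span_Lplus _ i _)

variable {lam : Fin r → ℕ}

theorem can_eq_zero {w : U0 k A r} (hw : w ∈ J k A lam) : can k A lam w = 0 := by
  rw [← map_zero (can k A lam)]
  exact (RingCon.eq _).2 hw

theorem can_H_of_eq_zero {i : Fin r} (hi : lam i = 0) (a b : A) :
    can k A lam (ι k (H k i a b)) = 0 := by
  refine can_eq_zero (TwoSidedIdeal.subset_span (Set.mem_iUnion.2 ⟨i, Or.inl ?_⟩))
  rw [hcGenerators, hi]
  refine ⟨1, fun _ => i.castSucc, fun _ => i.succ, fun _ => e k i a, fun _ => f k i b,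
    fun _ => Fin.castSucc_lt_succ, fun _ => ⟨a, rfl⟩, fun _ => ⟨b, rfl⟩, by simp, ?_⟩
  simpa using isHC_e_f i a b

theorem can_H_of_eq_one {i : Fin r} (hi : lam i = 1) (a b c d : A) :
    can k A lam (ι k (H k i a c)) * can k A lam (ι k (H k i b d)) +
      can k A lam (ι k (H k i b c)) * can k A lam (ι k (H k i a d)) =
        can k A lam (ι k (H k i (b * c * a + a * c * b) d)) := by
  rw [← sub_eq_zero, ← map_mul (can k A lam), ← map_mul (can k A lam),
    ← map_add (can k A lam), ← map_sub (can k A lam)]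
  refine can_eq_zero (TwoSidedIdeal.subset_span (Set.mem_iUnion.2 ⟨i, Or.inl ?_⟩))
  rw [hcGenerators, hi]
  refine ⟨2, fun _ => i.castSucc, fun _ => i.succ, ![e k i a, e k i b], ![f k i c, f k i d],
    fun _ => Fin.castSucc_lt_succ, ?_, ?_, by simp, ?_⟩
  · rw [Fin.forall_fin_two]; exact ⟨⟨a, rfl⟩, ⟨b, rfl⟩⟩
  · refine Fin.forall_fin_two.2 ⟨⟨c, rfl⟩, ⟨d, rfl⟩⟩
  · simpa [List.ofFn_succ, mul_assoc] using isHC_e_e_f_f i a b c d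

theorem can_h_one (i : Fin r) : can k A lam (ι k (h k i (1 : A))) = (lam i : Seligman k A lam) := by
  rw [← sub_eq_zero, ← map_natCast (can k A lam), ← map_sub]
  exact can_eq_zero (TwoSidedIdeal.subset_span (Set.mem_iUnion.2 ⟨i, Or.inr rfl⟩))

end HarishChandra

/-! ### Consequences of the relations between τ and ρ -/

section Abstract

variable {k : Type*} [Field k] [CharZero k] {A S : Type*} [Ring A] [Algebra k A] [Ring S]
  [Algebra k S] {τ : A →ₗ[k] S} {ρ : A →ₐ[k] S}

/-- The associativity of `τ a * τ b * τ a` forces a relation on `τ + ρ`. -/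
theorem add_mul_commutator (hτ : ∀ a b, τ a * τ b = τ (a * b) + ρ (a * b - b * a))
    (hc : ∀ a b, (τ a + ρ a) * ρ b = ρ b * (τ a + ρ a)) (a b : A) :
    (τ a + ρ a) * ρ (b * a - a * b) = ρ (b * (a * a) - a * a * b) := by
  have h1 : τ (a * b) * τ a + ρ (a * b - b * a) * τ a =
      τ a * τ (b * a) + τ a * ρ (b * a - a * b) := by
    rw [← add_mul, ← mul_add, ← hτ, ← hτ, mul_assoc]
  rw [hτ, hτ, mul_assoc] at h1
  have h2 : ρ (b * a - a * b) * τ a =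
      (τ a + ρ a) * ρ (b * a - a * b) - ρ (b * a - a * b) * ρ a := by
    rw [hc]; noncomm_ring
  have h3 : τ a * ρ (b * a - a * b) =
      (τ a + ρ a) * ρ (b * a - a * b) - ρ a * ρ (b * a - a * b) := by
    noncomm_ring
  have h4 : ρ (a * b - b * a) = - ρ (b * a - a * b) := by rw [← map_neg, neg_sub]
  rw [h4, neg_mul, h2, h3] at h1
  generalize (τ a + ρ a) * ρ (b * a - a * b) = P at h1 ⊢
  rw [← map_mul, ← map_mul] at h1
  have h5 : P + P = ρ (b * (a * a) - a * a * b) + ρ (b * (a * a) - a * a * b) := by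
    have h6 : P + P = ρ (a * (b * a) - a * (a * b)) - ρ (a * (b * a) - b * a * a)
        + ρ ((b * a - a * b) * a) + ρ (a * (b * a - a * b)) := by
      linear_combination (norm := abel) -h1
    rw [h6, ← map_sub, ← map_add, ← map_add, ← map_add]
    congr 1
    noncomm_ring
  -- Associativity yields the claim only up to a factor 2, which is cancelled in characteristic
  -- zero.
  rw [← two_nsmul, ← two_nsmul, ← Nat.cast_smul_eq_nsmul k, ← Nat.cast_smul_eq_nsmul k] at h5
  exact smul_right_injective S (r := ((2 : ℕ) : k)) (by simp) h5

-- Since `P` commutes with the image of `ρ`, the elements killed by `P ∘ ρ` form a two-sided ideal.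
-- It contains E_pp = E_pi E_ij E_jp for every p, hence also 1.
omit [CharZero k] in
theorem eq_zero_of_mul_single_eq_zero {n : Type*} [Fintype n] [DecidableEq n]
    {P : S} {ρ : Matrix n n k →ₐ[k] S} (hc : ∀ b, P * ρ b = ρ b * P) {i j : n}
    (h : P * ρ (Matrix.single i j 1) = 0) : P = 0 := by
  have key : ∀ p : n, P * ρ (Matrix.single p p 1) = 0 := fun p => by
    have : (Matrix.single p p 1 : Matrix n n k) =
        Matrix.single p i 1 * Matrix.single i j 1 * Matrix.single j p 1 := by simp
    rw [this, map_mul, map_mul, ← mul_assoc, ← mul_assoc, hc, mul_assoc (ρ _) P, h, mul_zero,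
      zero_mul]
  have h1 : (1 : Matrix n n k) = ∑ p, Matrix.single p p 1 := by
    ext p q
    simp [Matrix.one_apply, Matrix.sum_apply, Matrix.single_apply, ite_and]
  rw [← mul_one P, ← map_one ρ, h1, map_sum, Finset.mul_sum]
  exact Finset.sum_eq_zero fun p _ => key p

/-- For b = E_ij the hypotheses give [b,a] = [b,a²] = -E_ij, so `add_mul_commutator` shows that τ(a)
+ ρ(a) - 1 kills ρ(E_ij). -/
theorem add_eq_one_of_idempotent {n : Type*} [Fintype n] [DecidableEq n]
    {τ : Matrix n n k →ₗ[k] S} {ρ : Matrix n n k →ₐ[k] S}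
    (hτ : ∀ a b, τ a * τ b = τ (a * b) + ρ (a * b - b * a))
    (hc : ∀ a b, (τ a + ρ a) * ρ b = ρ b * (τ a + ρ a)) {a : Matrix n n k} (ha : a * a = a)
    {i j : n} (h₁ : Matrix.single i j 1 * a = 0)
    (h₂ : a * Matrix.single i j 1 = Matrix.single i j 1) : τ a + ρ a = 1 := by
  rw [← sub_eq_zero]
  refine eq_zero_of_mul_single_eq_zero (ρ := ρ) (i := i) (j := j) (fun b => ?_) ?_
  · rw [sub_mul, mul_sub, hc, one_mul, mul_one]
  · have := add_mul_commutator hτ hc a (Matrix.single i j 1)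
    rw [ha, h₁, h₂, zero_sub, map_neg, mul_neg, neg_inj] at this
    rw [sub_mul, this, one_mul, sub_self]

/-- E_ii, E_jj and E_ii + E_jj are all idempotents to which the previous lemma applies. The third
index `l` is what provides a matrix unit E_il for the sum. -/
theorem subsingleton_of_matrix {n : Type*} [Fintype n] [DecidableEq n]
    {τ : Matrix n n k →ₗ[k] S} {ρ : Matrix n n k →ₐ[k] S}
    (hτ : ∀ a b, τ a * τ b = τ (a * b) + ρ (a * b - b * a))
    (hc : ∀ a b, (τ a + ρ a) * ρ b = ρ b * (τ a + ρ a))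
    {i j l : n} (hij : i ≠ j) (hil : i ≠ l) (hjl : j ≠ l) : Subsingleton S := by
  have h1 : τ (Matrix.single i i 1) + ρ (Matrix.single i i 1) = 1 :=
    add_eq_one_of_idempotent hτ hc (i := i) (j := j) (by simp) (by simp [hij.symm]) (by simp)
  have h2 : τ (Matrix.single j j 1) + ρ (Matrix.single j j 1) = 1 :=
    add_eq_one_of_idempotent hτ hc (i := j) (j := i) (by simp) (by simp [hij]) (by simp)
  have h3 : τ (Matrix.single i i 1 + Matrix.single j j 1) +
      ρ (Matrix.single i i 1 + Matrix.single j j 1) = 1 :=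
    add_eq_one_of_idempotent hτ hc (i := i) (j := l)
      (by simp [mul_add, add_mul, hij, hij.symm])
      (by simp [mul_add, hil.symm, hjl.symm]) (by simp [add_mul, hij.symm])
  rw [map_add, map_add, add_add_add_comm, h1, h2] at h3
  exact subsingleton_of_zero_eq_one (Eq.symm (by simpa using h3))

/-- If `a * a` is central and some commutator with `a` is invertible, then `τ + ρ` vanishes
at `a`. -/
theorem add_eq_zero_of_sq_central (hτ : ∀ a b, τ a * τ b = τ (a * b) + ρ (a * b - b * a))
    (hc : ∀ a b, (τ a + ρ a) * ρ b = ρ b * (τ a + ρ a)) {a b c : A}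
    (ha : b * (a * a) = a * a * b) (hb : (b * a - a * b) * c = 1) : τ a + ρ a = 0 := by
  have := add_mul_commutator hτ hc a b
  rw [ha, sub_self, map_zero] at this
  rw [← mul_one (τ a + ρ a), ← map_one ρ, ← hb, map_mul, ← mul_assoc, this, zero_mul]

end Abstract

/-! ### Diagonal matrices in sl_{r+1}(A) -/

section Diagonal

variable (k : Type u) [Field k] {A : Type v} [Ring A] [Algebra k A] {r : ℕ}

variable (A r) in
/-- The matrix of an element of `L_0`. -/
noncomputable def mat : L0 k A r →ₗ[k] Gl A r :=
  (sl k A r).subtype ∘ₗ (L0 k A r).subtype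

variable {k} in
theorem mat_injective {x y : L0 k A r} (hxy : mat k A r x = mat k A r y) : x = y :=
  Subtype.ext (Subtype.ext hxy)

theorem mat_lie (x y : L0 k A r) :
    mat k A r ⁅x, y⁆ = mat k A r x * mat k A r y - mat k A r y * mat k A r x := rfl

theorem mat_H (i : Fin r) (a b : A) : mat k A r (H k i a b) =
    Matrix.single i.castSucc i.castSucc (a * b) - Matrix.single i.succ i.succ (b * a) := by
  change (⁅(Matrix.single i.castSucc i.succ a : Gl A r),
    (Matrix.single i.succ i.castSucc b : Gl A r)⁆) = _
  rw [LieRing.of_associative_ring_bracket, Matrix.single_mul_single_same,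
    Matrix.single_mul_single_same]

theorem mat_h (i : Fin r) (a : A) : mat k A r (h k i a) =
    Matrix.single i.castSucc i.castSucc a - Matrix.single i.succ i.succ a := by
  rw [h, mat_H, mul_one, one_mul]

theorem single_sub' {n : Type*} [DecidableEq n] (p q : n) (a b : A) :
    Matrix.single p q (a - b) = Matrix.single p q a - Matrix.single p q b := by
  rw [eq_sub_iff_add_eq, ← Matrix.single_add, sub_add_cancel]

/-- `h_i` as a linear map. -/
noncomputable def hLin (i : Fin r) : A →ₗ[k] L0 k A r where
  toFun := h k i
  map_add' a b := mat_injective <| by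
    rw [map_add]; simp only [mat_h, Matrix.single_add]; abel
  map_smul' c a := mat_injective <| by
    rw [map_smul]; simp only [mat_h, smul_sub, Matrix.smul_single, RingHom.id_apply]

theorem H_one (i : Fin r) (a : A) : H k i 1 a = h k i a := mat_injective <| by
  rw [mat_H, mat_h, mul_one, one_mul]

theorem trace_mem_span_commutators (x : sl k A r) :
    ∑ p, (x : Gl A r) p p ∈ Submodule.span k {c : A | ∃ a b, c = a * b - b * a} := by
  obtain ⟨x, hx⟩ := x
  change ∑ p, x p p ∈ _
  have hx' : x ∈ (⁅(⊤ : LieIdeal k (Gl A r)), (⊤ : LieIdeal k (Gl A r))⁆ :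
    LieIdeal k (Gl A r)).toSubmodule := hx
  rw [LieSubmodule.lieIdeal_oper_eq_linear_span'] at hx'
  clear hx
  induction hx' using Submodule.span_induction with
  | mem x hx =>
    obtain ⟨y, -, z, -, rfl⟩ := hx
    have : ∑ p, (⁅y, z⁆ : Gl A r) p p = ∑ p, ∑ q, (y p q * z q p - z q p * y p q) := by
      simp only [LieRing.of_associative_ring_bracket, Matrix.sub_apply, Matrix.mul_apply,
        Finset.sum_sub_distrib]
      congr 1
      exact Finset.sum_comm
    rw [this]
    exact Submodule.sum_mem _ fun p _ => Submodule.sum_mem _ fun q _ =>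
      Submodule.subset_span ⟨_, _, rfl⟩
  | zero => simp
  | add x y _ _ hx hy => simpa [Finset.sum_add_distrib] using add_mem hx hy
  | smul c x _ hx => simpa [Finset.smul_sum] using Submodule.smul_mem _ c hx

end Diagonal

/-! ### The maps h_1 and h_2 into S^λ for λ = ϖ_1 + ϖ_2 -/

section Seligman

variable {k : Type u} [Field k] {A : Type v} [Ring A] [Algebra k A]

variable (k A) in
/-- The Seligman algebra of `(sl_4(A), sl_4(k))` for `ϖ_1 + ϖ_2`. -/
abbrev S110 : Type (max u v) := Seligman k A (r := 3) ![1, 1, 0]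

variable (k A) in
/-- The canonical map `L_0 → S^λ`. -/
noncomputable def can₀ : L0 k A 3 →ₗ[k] S110 k A :=
  (can k A ![1, 1, 0]).toLinearMap ∘ₗ (ι k : L0 k A 3 →ₗ⁅k⁆ U0 k A 3).toLinearMap

theorem can₀_apply (x : L0 k A 3) : can₀ k A x = can k A ![1, 1, 0] (ι k x) := rfl

theorem can₀_lie (x y : L0 k A 3) :
    can₀ k A ⁅x, y⁆ = can₀ k A x * can₀ k A y - can₀ k A y * can₀ k A x := by
  rw [can₀_apply, LieHom.map_lie, LieRing.of_associative_ring_bracket, map_sub, map_mul, map_mul]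
  rfl

theorem can₀_H_two (a b : A) : can₀ k A (H k (2 : Fin 3) a b) = 0 :=
  can_H_of_eq_zero (by simp) a b

theorem can₀_h_two (a : A) : can₀ k A (h k (2 : Fin 3) a) = 0 := can₀_H_two a 1

/-- With both inner arguments equal to 1, `can_H_of_eq_one` reads h_i(a)h_i(b) + h_i(1)H_i(a,b) =
2H_i(a,b), and h_i(1) becomes 1. -/
theorem can₀_h_mul_h {i : Fin 3} (hi : (![1, 1, 0] : Fin 3 → ℕ) i = 1) (a b : A) :
    can₀ k A (h k i a) * can₀ k A (h k i b) = can₀ k A (H k i a b) := by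
  have h1 : can₀ k A (h k i 1) = 1 := by
    rw [can₀_apply, can_h_one, hi, Nat.cast_one]
  have := can_H_of_eq_one (k := k) hi a 1 1 b
  rw [H_one, one_mul, one_mul, mul_one, mul_one] at this
  simp only [← can₀_apply] at this
  have h2 : H k i (a + a) b = H k i a b + H k i a b := mat_injective <| by
    rw [map_add]
    simp only [mat_H, add_mul, mul_add, Matrix.single_add]; abel
  change can₀ k A (h k i a) * _ + can₀ k A (h k i 1) * _ = _ at this
  rw [h1, one_mul, h2, map_add] at this
  exact add_right_cancel this

/-- The bracketed term is [a,b] in the third diagonal slot, and it dies in S^λ because ℓ_3 = 0. -/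
theorem H_zero_eq (a b : A) : H k (0 : Fin 3) a b =
    h k 0 (a * b) + h k 1 (a * b - b * a) +
      (H k (2 : Fin 3) a b - h k (2 : Fin 3) (b * a)) := mat_injective <| by
  simp only [map_add, map_sub, mat_H, mat_h, single_sub']
  simp only [Fin.isValue, Fin.castSucc_zero, Fin.succ_zero_eq_one, Fin.castSucc_one,
    Fin.succ_one_eq_two, Fin.reduceCastSucc]
  abel

theorem H_one_eq (a b : A) : H k (1 : Fin 3) a b =
    h k 1 (a * b) + (H k (2 : Fin 3) a b - h k (2 : Fin 3) (b * a)) := mat_injective <| by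
  simp only [map_add, map_sub, mat_H, mat_h]
  simp only [Fin.isValue, Fin.castSucc_one, Fin.succ_one_eq_two, Fin.reduceCastSucc]
  abel

theorem can₀_H_one (a b : A) : can₀ k A (H k 1 a b) = can₀ k A (h k 1 (a * b)) := by
  rw [H_one_eq, map_add, map_sub, can₀_H_two, can₀_h_two, sub_zero, add_zero]

variable (k A) in
/-- The algebra homomorphism `a ↦ h_2(a) + J^λ`. -/
noncomputable def hTwo : A →ₐ[k] S110 k A :=
  AlgHom.ofLinearMap (can₀ k A ∘ₗ hLin k 1)
    (by
      change can₀ k A (h k 1 1) = 1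
      rw [can₀_apply, can_h_one]; simp)
    (fun a b => by
      change can₀ k A (h k 1 (a * b)) = can₀ k A (h k 1 a) * can₀ k A (h k 1 b)
      rw [can₀_h_mul_h (by simp), can₀_H_one])

theorem hTwo_apply (a : A) : hTwo k A a = can₀ k A (h k 1 a) := rfl

variable (k A) in
/-- The linear map `a ↦ h_1(a) + J^λ`. -/
noncomputable def hOne : A →ₗ[k] S110 k A := can₀ k A ∘ₗ hLin k 0

theorem hOne_apply (a : A) : hOne k A a = can₀ k A (h k 0 a) := rfl

theorem hOne_mul_hOne (a b : A) :
    hOne k A a * hOne k A b = hOne k A (a * b) + hTwo k A (a * b - b * a) := by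
  rw [hOne_apply, hOne_apply, can₀_h_mul_h (by simp), H_zero_eq, map_add, map_add, map_sub,
    can₀_H_two, can₀_h_two, sub_zero, add_zero]
  rfl

/-- h_1(a) + h_2(a) lives in diagonal slots 1 and 3, so its bracket with h_2(b) is [a,b] in slot 3,
which vanishes in S^λ. -/
theorem hOne_add_hTwo_mul_hTwo (a b : A) :
    (hOne k A a + hTwo k A a) * hTwo k A b = hTwo k A b * (hOne k A a + hTwo k A a) := by
  rw [← sub_eq_zero, hOne_apply, hTwo_apply, hTwo_apply, ← map_add, ← can₀_lie]
  have : ⁅h k (0 : Fin 3) a + h k 1 a, h k 1 b⁆ =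
      H k (2 : Fin 3) a b - h k (2 : Fin 3) (b * a) := mat_injective <| by
    simp only [mat_lie, map_add, map_sub, mat_H, mat_h]
    simp only [Fin.isValue, Fin.castSucc_zero, Fin.succ_zero_eq_one, Fin.castSucc_one,
      Fin.succ_one_eq_two, Fin.reduceCastSucc, Fin.reduceSucc, sub_add_sub_cancel]
    simp [mul_sub, sub_mul]
  rw [this, map_sub, can₀_H_two, can₀_h_two, sub_zero]

/-- Subtracting suitable h_i from a diagonal matrix leaves its trace in the last slot. For an
element of sl_4(A) the trace is a sum of commutators, and [a,b] in the last slot equals H_3(a,b) -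
h_3(ab), which maps to 0. -/
theorem can₀_eq (x : L0 k A 3) :
    can₀ k A x = hOne k A (mat k A 3 x 0 0) +
      hTwo k A (mat k A 3 x 0 0 + mat k A 3 x 1 1) := by
  have key : ∀ c ∈ Submodule.span k {c : A | ∃ a b, c = a * b - b * a},
      ∃ y : L0 k A 3, mat k A 3 y = Matrix.single 3 3 c ∧ can₀ k A y = 0 := by
    intro c hc
    induction hc using Submodule.span_induction with
    | mem c hc =>
      obtain ⟨a, b, rfl⟩ := hc
      refine ⟨H k (2 : Fin 3) a b - h k (2 : Fin 3) (a * b), ?_, ?_⟩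
      · simp only [map_sub, mat_H, mat_h, single_sub']
        simp only [Fin.isValue, Fin.reduceSucc]
        abel
      · rw [map_sub, can₀_H_two, can₀_h_two, sub_zero]
    | zero => exact ⟨0, by simp, by simp⟩
    | add c d _ _ hc hd =>
      obtain ⟨y, hy, hy'⟩ := hc
      obtain ⟨z, hz, hz'⟩ := hd
      refine ⟨y + z, ?_, by rw [map_add, hy', hz', add_zero]⟩
      rw [map_add, hy, hz, Matrix.single_add]
    | smul t c _ hc =>
      obtain ⟨y, hy, hy'⟩ := hc
      refine ⟨t • y, ?_, by rw [map_smul, hy', smul_zero]⟩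
      rw [map_smul, hy, Matrix.smul_single]
  obtain ⟨y, hy, hy'⟩ := key _ (trace_mem_span_commutators k (x : sl k A 3))
  set X : Gl A 3 := mat k A 3 x with hX
  have : x = h k 0 (X 0 0) + h k 1 (X 0 0 + X 1 1) + h k (2 : Fin 3) (X 0 0 + X 1 1 + X 2 2) + y :=
    mat_injective <| by
    simp only [map_add, ← hX, mat_h]
    rw [hy]
    change X = _ + Matrix.single 3 3 (∑ p, X p p)
    have hd : X.IsDiag := x.2
    rw [← hd.diagonal_diag]
    ext p q
    fin_cases p <;> fin_cases q <;>
      simp [Fin.sum_univ_four, show Fin.castSucc (2 : Fin 3) = 2 from rfl] <;> abel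
  conv_lhs => rw [this, map_add, map_add, map_add, hy', can₀_h_two, add_zero, add_zero]
  rfl

end Seligman

/-! ### Alternating 3-tensors on K^4 ⊗ K^2 and their weights -/

section Tensors

open Matrix Kronecker

variable {K : Type*} [Field K] {I : Type*} [Fintype I] [DecidableEq I]

/-- The action of a matrix on tensors of order three, as a derivation. -/
def tensorDer (g : Matrix I I K) : Matrix (I × I × I) (I × I × I) K :=
  g ⊗ₖ (1 : Matrix (I × I) (I × I) K) +
    (1 : Matrix I I K) ⊗ₖ (g ⊗ₖ (1 : Matrix I I K)) +
    (1 : Matrix I I K) ⊗ₖ ((1 : Matrix I I K) ⊗ₖ g)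

omit [Fintype I] [DecidableEq I] in
theorem sub_kronecker' {J : Type*} (a b : Matrix I I K) (c : Matrix J J K) :
    (a - b) ⊗ₖ c = a ⊗ₖ c - b ⊗ₖ c := by
  ext; simp [sub_mul]

omit [Fintype I] [DecidableEq I] in
theorem kronecker_sub' {J : Type*} (a b : Matrix I I K) (c : Matrix J J K) :
    c ⊗ₖ (a - b) = c ⊗ₖ a - c ⊗ₖ b := by
  ext; simp [mul_sub]

theorem tensorDer_lie (g g' : Matrix I I K) :
    tensorDer (g * g' - g' * g) = tensorDer g * tensorDer g' - tensorDer g' * tensorDer g := by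
  simp only [tensorDer, mul_add, add_mul, ← mul_kronecker_mul, one_mul, mul_one, sub_kronecker',
    kronecker_sub']
  abel

theorem tensorDer_mulVec (g : Matrix I I K) (T : I × I × I → K) (i j l : I) :
    (tensorDer g *ᵥ T) (i, j, l) = ∑ p, g i p * T (p, j, l) + ∑ p, g j p * T (i, p, l) +
      ∑ p, g l p * T (i, j, p) := by
  simp only [tensorDer, add_mulVec, Pi.add_apply]
  simp [mulVec, dotProduct, Fintype.sum_prod_type, one_apply]

/-- The derivations `tensorDer g`, for `g` in a Lie algebra of matrices over a `k`-algebra. -/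
def tensorDerₗ (k : Type*) [Field k] [Algebra k K] :
    Matrix I I K →ₗ[k] Matrix (I × I × I) (I × I × I) K where
  toFun := tensorDer
  map_add' g g' := by
    simp only [tensorDer, add_kronecker, kronecker_add]; abel
  map_smul' c g := by
    simp only [tensorDer, smul_kronecker, kronecker_smul, smul_add, RingHom.id_apply]

/-- The weight of a basis tensor. -/
def tensorWeight (i j l : Fin 4 × Fin 2) : Fin 4 → ℤ :=
  Pi.single i.1 1 + Pi.single j.1 1 + Pi.single l.1 1

variable (K) in
/-- The alternating tensors of weight `μ`. -/
def altWeight (μ : Fin 4 → ℤ) :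
    Submodule K ((Fin 4 × Fin 2) × (Fin 4 × Fin 2) × (Fin 4 × Fin 2) → K) where
  carrier := {T | (∀ i j l, T (j, i, l) = - T (i, j, l)) ∧ (∀ i j l, T (i, l, j) = - T (i, j, l)) ∧
    ∀ i j l, T (i, j, l) ≠ 0 → tensorWeight i j l = μ}
  add_mem' {T T'} hT hT' := by
    refine ⟨fun i j l => ?_, fun i j l => ?_, fun i j l hn => ?_⟩
    · simp only [Pi.add_apply, hT.1 i j l, hT'.1 i j l]; ring
    · simp only [Pi.add_apply, hT.2.1 i j l, hT'.2.1 i j l]; ring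
    · by_cases h : T (i, j, l) = 0
      · refine hT'.2.2 i j l fun h' => hn ?_
        rw [Pi.add_apply, h, h', add_zero]
      · exact hT.2.2 i j l h
  zero_mem' := by simp
  smul_mem' c T hT := by
    refine ⟨fun i j l => ?_, fun i j l => ?_, fun i j l hn => ?_⟩
    · simp [hT.1 i j l]
    · simp [hT.2.1 i j l]
    · refine hT.2.2 i j l fun h' => hn ?_
      rw [Pi.smul_apply, h', smul_zero]

/-- A matrix shifts weights by `δ`. -/
def HasDegree (g : Matrix (Fin 4 × Fin 2) (Fin 4 × Fin 2) K) (δ : Fin 4 → ℤ) : Prop :=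
  ∀ i j, g i j ≠ 0 → (Pi.single i.1 1 - Pi.single j.1 1 : Fin 4 → ℤ) = δ

theorem tensorDer_mulVec_mem {g : Matrix (Fin 4 × Fin 2) (Fin 4 × Fin 2) K} {δ μ : Fin 4 → ℤ}
    (hg : HasDegree g δ) {T : (Fin 4 × Fin 2) × (Fin 4 × Fin 2) × (Fin 4 × Fin 2) → K}
    (hT : T ∈ altWeight K μ) : tensorDer g *ᵥ T ∈ altWeight K (μ + δ) := by
  refine ⟨fun i j l => ?_, fun i j l => ?_, fun i j l hn => ?_⟩
  · simp only [tensorDer_mulVec, fun p => hT.1 i p l, fun p => hT.1 p j l, fun p => hT.1 i j p,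
      mul_neg, Finset.sum_neg_distrib]
    ring
  · simp only [tensorDer_mulVec, fun p => hT.2.1 i p l, fun p => hT.2.1 p j l,
      fun p => hT.2.1 i j p, mul_neg, Finset.sum_neg_distrib]
    ring
  · rw [tensorDer_mulVec] at hn
    have aux : (∃ p, g i p * T (p, j, l) ≠ 0) ∨ (∃ p, g j p * T (i, p, l) ≠ 0) ∨
        ∃ p, g l p * T (i, j, p) ≠ 0 := by
      by_contra hcon
      simp only [not_or, not_exists, not_not] at hcon
      exact hn (by simp [hcon.1, hcon.2.1, hcon.2.2])
    rcases aux with ⟨p, hp⟩ | ⟨p, hp⟩ | ⟨p, hp⟩ <;>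
    · have h1 := hg _ _ (left_ne_zero_of_mul hp)
      have h2 := hT.2.2 _ _ _ (right_ne_zero_of_mul hp)
      rw [← h1, ← h2, tensorWeight, tensorWeight]
      abel

theorem altWeight_eq_bot_of_neg {μ : Fin 4 → ℤ} {p : Fin 4} (hp : μ p < 0) :
    altWeight K μ = ⊥ := by
  rw [eq_bot_iff]
  intro T hT
  rw [Submodule.mem_bot]
  ext ⟨i, j, l⟩
  by_contra hn
  have := congrFun (hT.2.2 i j l hn) p
  simp only [tensorWeight, Pi.add_apply, Pi.single_apply] at this
  split_ifs at this <;> omega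

/-- Such a tensor would be an alternating 3-tensor on the two-dimensional space e_p ⊗ K^2. -/
theorem altWeight_eq_bot_of_three [CharZero K] {μ : Fin 4 → ℤ} {p : Fin 4} (hp : μ p = 3) :
    altWeight K μ = ⊥ := by
  rw [eq_bot_iff]
  intro T hT
  rw [Submodule.mem_bot]
  ext ⟨i, j, l⟩
  by_contra hn
  have := congrFun (hT.2.2 i j l hn) p
  simp only [tensorWeight, Pi.add_apply, Pi.single_apply, hp] at this
  have h3 : p = i.1 ∧ p = j.1 ∧ p = l.1 := by split_ifs at this <;> simp_all
  obtain ⟨hi, hj, hl⟩ := h3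
  have h12 : ∀ i l, T (i, i, l) = 0 := fun i l => self_eq_neg.1 (hT.1 i i l)
  have h23 : ∀ i l, T (i, l, l) = 0 := fun i l => self_eq_neg.1 (hT.2.1 i l l)
  have h13 : ∀ i l, T (l, i, l) = 0 := fun i l => by rw [hT.1 i l l, h23, neg_zero]
  have : i.2 = j.2 ∨ j.2 = l.2 ∨ i.2 = l.2 := by
    generalize i.2 = a, j.2 = b, l.2 = c; revert a b c; decide
  rcases this with h | h | h
  · obtain rfl : i = j := Prod.ext (hi.symm.trans hj) h
    exact hn (h12 _ _)
  · obtain rfl : j = l := Prod.ext (hj.symm.trans hl) h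
    exact hn (h23 _ _)
  · obtain rfl : i = l := Prod.ext (hi.symm.trans hl) h
    exact hn (h13 _ _)

theorem altWeight_ne_bot : altWeight K ![2, 1, 0, 0] ≠ ⊥ := by
  let δ (u i : Fin 4 × Fin 2) : K := if i = u then 1 else 0
  -- The wedge of the basis vectors (0,0), (0,1), (1,0), written as a 3×3 determinant expanded along
  -- the first tensor slot.
  let T : (Fin 4 × Fin 2) × (Fin 4 × Fin 2) × (Fin 4 × Fin 2) → K := fun x =>
    δ (0, 0) x.1 * (δ (0, 1) x.2.1 * δ (1, 0) x.2.2 - δ (1, 0) x.2.1 * δ (0, 1) x.2.2) -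
    δ (0, 1) x.1 * (δ (0, 0) x.2.1 * δ (1, 0) x.2.2 - δ (1, 0) x.2.1 * δ (0, 0) x.2.2) +
    δ (1, 0) x.1 * (δ (0, 0) x.2.1 * δ (0, 1) x.2.2 - δ (0, 1) x.2.1 * δ (0, 0) x.2.2)
  have hT : T ∈ altWeight K ![2, 1, 0, 0] := by
    refine ⟨fun i j l => by simp only [T]; ring, fun i j l => by simp only [T]; ring,
      fun i j l hn => ?_⟩
    have hδ : ∀ {u v w : Fin 4 × Fin 2}, δ u i * (δ v j * δ w l) ≠ 0 → i = u ∧ j = v ∧ l = w := by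
      intro u v w h
      simpa [δ, and_comm, and_assoc, and_left_comm] using h
    by_contra hw
    have hz : ∀ u v w : Fin 4 × Fin 2, tensorWeight u v w = ![2, 1, 0, 0] →
        δ u i * (δ v j * δ w l) = 0 := fun u v w huvw => by
      by_contra h
      obtain ⟨rfl, rfl, rfl⟩ := hδ h
      exact hw huvw
    refine hn ?_
    simp only [T, mul_sub]
    rw [hz, hz, hz, hz, hz, hz]
    · simp
    all_goals decide
  intro hbot
  rw [hbot, Submodule.mem_bot] at hT
  have := congrFun hT ((0, 0), (0, 1), (1, 0))
  simp [T, δ] at this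

end Tensors

/-! ### Non-vanishing of S^λ when A maps to 2×2 matrices over a field -/

section Representation

open Matrix

variable {k : Type u} [Field k] {A : Type v} [Ring A] [Algebra k A] {K : Type*} [Field K]
  [Algebra k K] (θ : A →ₐ[k] Matrix (Fin 2) (Fin 2) K)

/-- The homomorphism `Mat_4(A) → Mat_8(K)` induced by `A → Mat_2(K)`. -/
def toGl : Gl A 3 →ₐ[k] Matrix (Fin 4 × Fin 2) (Fin 4 × Fin 2) K :=
  (compAlgEquiv (Fin 4) (Fin 2) K k).toAlgHom.comp θ.mapMatrix

theorem toGl_apply (X : Gl A 3) (i j : Fin 4 × Fin 2) :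
    toGl θ X i j = θ (X i.1 j.1) i.2 j.2 := rfl

/-- The representation of `sl_4(A)` on tensors of order three. -/
noncomputable def tensorRep : sl k A 3 →ₗ⁅k⁆
    Matrix ((Fin 4 × Fin 2) × (Fin 4 × Fin 2) × (Fin 4 × Fin 2))
      ((Fin 4 × Fin 2) × (Fin 4 × Fin 2) × (Fin 4 × Fin 2)) K where
  toLinearMap := tensorDerₗ k ∘ₗ (toGl θ).toLinearMap ∘ₗ (sl k A 3).subtype
  map_lie' {x y} := by
    change tensorDer (toGl θ ((x : Gl A 3) * (y : Gl A 3) - (y : Gl A 3) * (x : Gl A 3))) =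
      tensorDer (toGl θ x) * tensorDer (toGl θ y) - tensorDer (toGl θ y) * tensorDer (toGl θ x)
    rw [map_sub, map_mul, map_mul, tensorDer_lie]

/-- The representation of `U(sl_4(A))` on tensors of order three. -/
noncomputable def tensorRepU : U k A 3 →ₐ[k]
    Matrix ((Fin 4 × Fin 2) × (Fin 4 × Fin 2) × (Fin 4 × Fin 2))
      ((Fin 4 × Fin 2) × (Fin 4 × Fin 2) × (Fin 4 × Fin 2)) K :=
  lift k (tensorRep θ)

theorem tensorRepU_ι (x : sl k A 3) : tensorRepU θ (ι k x) = tensorDer (toGl θ x) := by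
  rw [tensorRepU, lift_ι_apply]; rfl

theorem hasDegree_single {p q : Fin 4} {X : Gl A 3} (a : A) (hX : X = Matrix.single p q a) :
    HasDegree (toGl θ X) (root 3 p q) := by
  intro i j hij
  rw [toGl_apply, hX, Matrix.single_apply] at hij
  split_ifs at hij with h
  · rw [root, h.1, h.2]
  · simp at hij

theorem hasDegree_diag {X : Gl A 3} (hX : X.IsDiag) : HasDegree (toGl θ X) 0 := by
  intro i j hij
  by_cases h : i.1 = j.1
  · rw [h, sub_self]
  · rw [toGl_apply, hX h] at hij
    simp at hij

theorem tensorRepU_incl_mem {μ : Fin 4 → ℤ} (w : U0 k A 3)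
    {T : (Fin 4 × Fin 2) × (Fin 4 × Fin 2) × (Fin 4 × Fin 2) → K} (hT : T ∈ altWeight K μ) :
    tensorRepU θ (incl k A 3 w) *ᵥ T ∈ altWeight K μ := by
  let S : Subalgebra k (Matrix ((Fin 4 × Fin 2) × (Fin 4 × Fin 2) × (Fin 4 × Fin 2))
      ((Fin 4 × Fin 2) × (Fin 4 × Fin 2) × (Fin 4 × Fin 2)) K) :=
    { carrier := {M | ∀ T ∈ altWeight K μ, M *ᵥ T ∈ altWeight K μ}
      mul_mem' := fun {M N} hM hN T hT => by
        rw [← mulVec_mulVec]; exact hM _ (hN T hT)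
      add_mem' := fun {M N} hM hN T hT => by
        rw [add_mulVec]; exact add_mem (hM T hT) (hN T hT)
      algebraMap_mem' := fun c T hT => by
        rw [Algebra.algebraMap_eq_smul_one, smul_mulVec, one_mulVec,
          ← algebraMap_smul K c T]
        exact Submodule.smul_mem _ _ hT }
  refine map_mem_of_map_ι_mem S ((tensorRepU θ).comp (incl k A 3)) (fun x T hT => ?_) w T hT
  rw [AlgHom.comp_apply, incl_ι, tensorRepU_ι, ← add_zero μ]
  exact tensorDer_mulVec_mem (hasDegree_diag θ x.2) hT

theorem prod_mulVec_mem {i : Fin 3} {n : ℕ} {y : Fin n → sl k A 3}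
    (hy : ∀ j, y j ∈ rootSpace k A (r := 3) i.succ i.castSucc) {μ : Fin 4 → ℤ}
    {T : (Fin 4 × Fin 2) × (Fin 4 × Fin 2) × (Fin 4 × Fin 2) → K} (hT : T ∈ altWeight K μ) :
    tensorRepU θ (List.ofFn fun j => ι k (y j)).prod *ᵥ T ∈
      altWeight K (μ + n • root 3 i.succ i.castSucc) := by
  induction n with
  | zero => simpa using hT
  | succ n ih =>
    obtain ⟨a, ha⟩ := hy 0
    rw [List.ofFn_succ, List.prod_cons, map_mul, ← mulVec_mulVec, tensorRepU_ι, succ_nsmul,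
      ← add_assoc]
    exact tensorDer_mulVec_mem (hasDegree_single θ a ha) (ih (fun j => hy j.succ))

theorem mulVec_eq_zero_of_mem_Lplus [CharZero K] {x : sl k A 3} (hx : x ∈ Lplus k A 3)
    {T : (Fin 4 × Fin 2) × (Fin 4 × Fin 2) × (Fin 4 × Fin 2) → K}
    (hT : T ∈ altWeight K ![2, 1, 0, 0]) : tensorRepU θ (ι k x) *ᵥ T = 0 := by
  rw [tensorRepU_ι]
  have hsum : (x : Gl A 3) = ∑ p, ∑ q, Matrix.single p q ((x : Gl A 3) p q) :=
    Matrix.matrix_eq_sum_single _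
  have : tensorDer (toGl θ x) =
      ∑ p, ∑ q, tensorDer (toGl θ (Matrix.single p q ((x : Gl A 3) p q))) := by
    conv_lhs => rw [hsum]
    simp only [map_sum]
    change tensorDerₗ k _ = ∑ p, ∑ q, tensorDerₗ k _
    simp only [map_sum]
  rw [this, sum_mulVec]
  refine Finset.sum_eq_zero fun p _ => ?_
  rw [sum_mulVec]
  refine Finset.sum_eq_zero fun q _ => ?_
  by_cases hpq : q ≤ p
  · rw [hx p q hpq, Matrix.single_zero, map_zero]
    change tensorDerₗ k 0 *ᵥ T = 0
    rw [map_zero, zero_mulVec]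
  · have hmem := tensorDer_mulVec_mem (hasDegree_single θ ((x : Gl A 3) p q)
      (rfl : Matrix.single p q ((x : Gl A 3) p q) = _)) hT
    rw [← Submodule.mem_bot K]
    convert hmem
    symm
    -- Only ε_0 - ε_1 avoids a negative coordinate, and it leads to the weight 3ε_0.
    have key : ∀ p q : Fin 4, ¬ q ≤ p → (![2, 1, 0, 0] + root 3 p q : Fin 4 → ℤ) 0 = 3 ∨
        (![2, 1, 0, 0] + root 3 p q : Fin 4 → ℤ) q < 0 := by decide
    exact (key p q hpq).elim altWeight_eq_bot_of_three altWeight_eq_bot_of_neg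

theorem sum_mulVec_eq_zero_of_mem_span [CharZero K] {z : U k A 3}
    (hz : z ∈ Submodule.span (U k A 3) (ι k '' Lplus k A 3))
    {T : (Fin 4 × Fin 2) × (Fin 4 × Fin 2) × (Fin 4 × Fin 2) → K}
    (hT : T ∈ altWeight K ![2, 1, 0, 0]) : tensorRepU θ z *ᵥ T = 0 := by
  induction hz using Submodule.span_induction with
  | mem z hz =>
    obtain ⟨x, hx, rfl⟩ := hz
    exact mulVec_eq_zero_of_mem_Lplus θ hx hT
  | zero => rw [map_zero, zero_mulVec]
  | add y z _ _ hy hz => rw [map_add, add_mulVec, hy, hz, add_zero]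
  | smul u z _ hz => rw [smul_eq_mul, map_mul, ← mulVec_mulVec, hz, mulVec_zero]

/-- A generator differs from x_1⋯x_m y_1⋯y_{ℓ+1} by an element of U(L)L_+, which kills `T`. The
y-product kills `T` as well, because subtracting (ℓ_i + 1)α_i leads to a weight with zero weight
space. -/
theorem hcGenerators_mulVec [CharZero K] {i : Fin 3} {w : U0 k A 3}
    (hw : w ∈ hcGenerators k A ![1, 1, 0] i)
    {T : (Fin 4 × Fin 2) × (Fin 4 × Fin 2) × (Fin 4 × Fin 2) → K}
    (hT : T ∈ altWeight K ![2, 1, 0, 0]) : tensorRepU θ (incl k A 3 w) *ᵥ T = 0 := by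
  obtain ⟨m, p, q, x, y, -, -, hy, -, -, hz⟩ := hw
  have h1 := sum_mulVec_eq_zero_of_mem_span θ hz.1 hT
  have h2 : tensorRepU θ (List.ofFn fun j => ι k (y j)).prod *ᵥ T = 0 := by
    have := prod_mulVec_mem θ hy hT
    rw [← Submodule.mem_bot K]
    convert this
    symm
    clear this hz h1 hy y
    fin_cases i
    -- The weights reached are (0,3,0,0), (2,-1,2,0) and (2,1,-1,1).
    · exact altWeight_eq_bot_of_three (p := 1) (by decide)
    · exact altWeight_eq_bot_of_neg (p := 1) (by decide)
    · exact altWeight_eq_bot_of_neg (p := 2) (by decide)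
  rw [map_sub, sub_mulVec, map_mul, ← mulVec_mulVec, h2, mulVec_zero, zero_sub, neg_eq_zero] at h1
  exact h1

theorem toGl_single_one (p : Fin 4) : toGl θ (Matrix.single p p 1) =
    Matrix.diagonal fun j : Fin 4 × Fin 2 => if j.1 = p then 1 else 0 := by
  ext i j
  obtain ⟨a, b⟩ := i
  obtain ⟨c, d⟩ := j
  rw [toGl_apply, Matrix.single_apply, Matrix.diagonal_apply]
  by_cases h : p = a <;> by_cases h' : p = c <;> by_cases h'' : b = d <;>
    simp_all [eq_comm]

theorem h_one_mulVec {i : Fin 3}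
    {T : (Fin 4 × Fin 2) × (Fin 4 × Fin 2) × (Fin 4 × Fin 2) → K}
    (hT : T ∈ altWeight K ![2, 1, 0, 0]) :
    tensorRepU θ (incl k A 3 (ι k (h k i 1) - ((![1, 1, 0] i : ℕ) : U0 k A 3))) *ᵥ T = 0 := by
  rw [map_sub, incl_ι, map_natCast, map_sub, map_natCast, sub_mulVec, sub_eq_zero, tensorRepU_ι]
  change tensorDer (toGl θ (mat k A 3 (h k i 1))) *ᵥ T = _
  rw [mat_h, map_sub, toGl_single_one, toGl_single_one, diagonal_sub]
  ext ⟨a, b, c⟩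
  rw [tensorDer_mulVec, natCast_mulVec]
  simp only [diagonal_apply, ite_mul, zero_mul, Finset.sum_ite_eq, Finset.mem_univ, if_true,
    Pi.smul_apply, ← add_mul]
  by_cases h0 : T (a, b, c) = 0
  · simp [h0]
  rw [smul_eq_mul]
  congr 1
  have hw := hT.2.2 a b c h0
  have h1 := congrFun hw i.castSucc
  have h2 := congrFun hw i.succ
  have h3 : (![2, 1, 0, 0] : Fin 4 → ℤ) i.castSucc - (![2, 1, 0, 0] : Fin 4 → ℤ) i.succ =
      ((![1, 1, 0] i : ℕ) : ℤ) := by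
    clear h1 h2; revert i; decide
  rw [← h1, ← h2] at h3
  have h4 := congrArg (Int.cast : ℤ → K) h3
  simp only [tensorWeight, Pi.add_apply, Pi.single_apply, Int.cast_sub, Int.cast_add,
    Int.cast_natCast, Int.cast_ite, Int.cast_one, Int.cast_zero, eq_comm (a := i.castSucc),
    eq_comm (a := i.succ)] at h4
  rw [← h4]
  ring

theorem nontrivial_of_algHom [CharZero K] (θ : A →ₐ[k] Matrix (Fin 2) (Fin 2) K) :
    Nontrivial (S110 k A) := by
  -- The annihilator of the weight space in U(L_0); it is two-sided because U(L_0) preserves that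
  -- space.
  let P : TwoSidedIdeal (U0 k A 3) := TwoSidedIdeal.mk'
    {w | ∀ T ∈ altWeight K ![2, 1, 0, 0], tensorRepU θ (incl k A 3 w) *ᵥ T = 0}
    (fun T _ => by simp)
    (fun {x y} hx hy T hT => by rw [map_add, map_add, add_mulVec, hx T hT, hy T hT, add_zero])
    (fun {x} hx T hT => by rw [map_neg, map_neg, neg_mulVec, hx T hT, neg_zero])
    (fun {x y} hy T hT => by rw [map_mul, map_mul, ← mulVec_mulVec, hy T hT, mulVec_zero])
    (fun {x y} hx T hT => by
      rw [map_mul, map_mul, ← mulVec_mulVec, hx _ (tensorRepU_incl_mem θ y hT)])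
  have hJ : J k A ![1, 1, 0] ≤ P := by
    refine TwoSidedIdeal.span_le.2 (Set.iUnion_subset fun i => Set.union_subset ?_ ?_)
    · exact fun w hw => (TwoSidedIdeal.mem_mk' _ _ _ _ _ _ _).2
        fun T hT => hcGenerators_mulVec θ hw hT
    · rintro _ rfl
      exact (TwoSidedIdeal.mem_mk' _ _ _ _ _ _ _).2 fun T hT => h_one_mulVec θ hT
  refine ⟨1, 0, fun h10 => altWeight_ne_bot (K := K) ?_⟩
  have h1 : (1 : U0 k A 3) ∈ P := hJ ((RingCon.eq _).1 (by
    change can k A ![1, 1, 0] 1 = can k A ![1, 1, 0] 0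
    rw [map_one, map_zero, h10]))
  rw [eq_bot_iff]
  intro T hT
  have := (TwoSidedIdeal.mem_mk' _ _ _ _ _ _ _).1 h1 T hT
  rwa [map_one, map_one, one_mulVec] at this

end Representation

/-! ### Generation of S^λ by the image of L_0 -/

section Generation

variable {k : Type u} [Field k] {A : Type v} [Ring A] [Algebra k A]

theorem mem_of_can₀_mem {S : Subalgebra k (S110 k A)} (hS : ∀ x, can₀ k A x ∈ S)
    (s : S110 k A) : s ∈ S := by
  obtain ⟨w, rfl⟩ : ∃ w, can k A ![1, 1, 0] w = s := Quotient.exists_rep s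
  exact map_mem_of_map_ι_mem S _ hS w

/-- If `a ↦ h_1(a) + h_2(a)` takes values in the image of `h_2`, then `h_2` is surjective. -/
theorem hTwo_surjective (h : ∀ a, hOne k A a + hTwo k A a ∈ (hTwo k A).range) :
    Function.Surjective (hTwo k A) := by
  refine fun s => mem_of_can₀_mem (S := (hTwo k A).range) (fun x => ?_) s
  rw [can₀_eq]
  refine add_mem ?_ ⟨_, rfl⟩
  rw [← add_sub_cancel_right (hOne k A _) (hTwo k A _)]
  exact sub_mem (h _) ⟨_, rfl⟩

end Generation

/-! ### The quaternion case -/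

section Quaternion

open Quaternion

variable {k : Type u} [Field k] [CharZero k] {A : Type v} [Ring A] [Algebra k A] {a b : k}

theorem nontrivial_of_quaternion (e : A ≃ₐ[k] ℍ[k,a,0,b]) : Nontrivial (S110 k A) := by
  obtain ⟨s, hs⟩ := IsAlgClosed.exists_eq_mul_self (algebraMap k (AlgebraicClosure k) a)
  let t := algebraMap k (AlgebraicClosure k) b
  -- The standard splitting by 2×2 matrices, available once a has a square root s.
  let B : QuaternionAlgebra.Basis (Matrix (Fin 2) (Fin 2) (AlgebraicClosure k)) a 0 b :=
    { i := !![s, 0; 0, -s]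
      j := !![0, t; 1, 0]
      k := !![0, s * t; -s, 0]
      i_mul_i := by
        ext i j; fin_cases i <;> fin_cases j <;> simp [← hs, Algebra.algebraMap_eq_smul_one]
      j_mul_j := by
        ext i j; fin_cases i <;> fin_cases j <;> simp [t, Algebra.algebraMap_eq_smul_one]
      i_mul_j := by
        ext i j; fin_cases i <;> fin_cases j <;> simp
      j_mul_i := by
        ext i j; fin_cases i <;> fin_cases j <;> simp [mul_comm] }
  have : CharZero (AlgebraicClosure k) := algebraRat.charZero _
  exact nontrivial_of_algHom (B.liftHom.comp e.toAlgHom)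

/-- Simplicity by averaging: summing the conjugates of x by 1, i, j, k gives 4 re(x), so a kernel
element has real part 0. Its other coordinates are, up to non-zero factors, the real parts of xi,
xj, xk. -/
theorem quaternion_ker_trivial {S : Type*} [Ring S] [Nontrivial S] (ha : a ≠ 0) (hb : b ≠ 0)
    (f : ℍ[k,a,0,b] →+* S) : Function.Injective f := by
  have key : ∀ x : ℍ[k,a,0,b], f x = 0 → x.re = 0 := by
    intro x hx
    -- The averaging identity multiplied by ab, which clears the denominators of the inverses of i,
    -- j, k.
    have h4 : (⟨4 * a * b * x.re, 0, 0, 0⟩ : ℍ[k,a,0,b]) =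
        (⟨a * b, 0, 0, 0⟩ : ℍ[k,a,0,b]) * x + ⟨0, b, 0, 0⟩ * x * ⟨0, 1, 0, 0⟩ +
          ⟨0, 0, a, 0⟩ * x * ⟨0, 0, 1, 0⟩ - ⟨0, 0, 0, 1⟩ * x * ⟨0, 0, 0, 1⟩ := by
      ext <;> simp <;> ring
    by_contra hne
    have hc : 4 * a * b * x.re ≠ 0 := by simp [ha, hb, hne]
    have h5 : (⟨(4 * a * b * x.re)⁻¹, 0, 0, 0⟩ : ℍ[k,a,0,b]) * ⟨4 * a * b * x.re, 0, 0, 0⟩ = 1 := by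
      ext <;> simp [-mul_inv_rev, inv_mul_cancel₀ hc]
    have h6 := congrArg f h5
    rw [h4] at h6
    simp [hx] at h6
  refine (injective_iff_map_eq_zero f).2 fun x hx => ?_
  have hi := key (x * ⟨0, 1, 0, 0⟩) (by rw [map_mul, hx, zero_mul])
  have hj := key (x * ⟨0, 0, 1, 0⟩) (by rw [map_mul, hx, zero_mul])
  have hk := key (x * ⟨0, 0, 0, 1⟩) (by rw [map_mul, hx, zero_mul])
  ext
  · exact key x hx
  · simpa [ha] using hi
  · simpa [hb] using hj
  · simpa [ha, hb] using hk

theorem hTwo_bijective_of_quaternion (ha : a ≠ 0) (hb : b ≠ 0) (e : A ≃ₐ[k] ℍ[k,a,0,b]) :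
    Function.Bijective (hTwo k A) := by
  have := nontrivial_of_quaternion e
  constructor
  · have h := quaternion_ker_trivial ha hb ((hTwo k A).comp e.symm.toAlgHom).toRingHom
    intro x y hxy
    have h' : e x = e y := h (by
      change hTwo k A (e.symm (e x)) = hTwo k A (e.symm (e y))
      simpa using hxy)
    exact e.injective h'
  · have main : ∀ x y z : ℍ[k,a,0,b], y * (x * x) = x * x * y → (y * x - x * y) * z = 1 →
        hOne k A (e.symm x) + hTwo k A (e.symm x) = 0 := fun x y z h₁ h₂ =>
      add_eq_zero_of_sq_central hOne_mul_hOne hOne_add_hTwo_mul_hTwo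
        (a := e.symm x) (b := e.symm y) (c := e.symm z)
        (by simp only [← map_mul, h₁]) (by simp only [← map_mul, ← map_sub, h₂, map_one])
    -- The third argument inverts the commutator: [j,i] = -2k and k² = -ab. The next two are
    -- analogous.
    have hI := main ⟨0, 1, 0, 0⟩ ⟨0, 0, 1, 0⟩ ⟨0, 0, 0, (2 * a * b)⁻¹⟩
      (by ext <;> simp) (by ext <;> simp; field_simp; ring)
    have hJ := main ⟨0, 0, 1, 0⟩ ⟨0, 1, 0, 0⟩ ⟨0, 0, 0, -(2 * a * b)⁻¹⟩
      (by ext <;> simp) (by ext <;> simp; field_simp; ring)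
    have hK := main ⟨0, 0, 0, 1⟩ ⟨0, 1, 0, 0⟩ ⟨0, 0, (2 * a * b)⁻¹, 0⟩
      (by ext <;> simp) (by ext <;> simp; field_simp; ring)
    have h1 : hOne k A 1 = 1 := by
      rw [hOne_apply, can₀_apply, can_h_one]; simp
    refine hTwo_surjective fun x => ?_
    have hx : x = (e x).re • (1 : A) + (e x).imI • e.symm ⟨0, 1, 0, 0⟩ +
        (e x).imJ • e.symm ⟨0, 0, 1, 0⟩ + (e x).imK • e.symm ⟨0, 0, 0, 1⟩ := by
      apply e.injective
      simp only [map_add, map_smul, AlgEquiv.apply_symm_apply, map_one]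
      ext <;> simp
    let g : A →ₗ[k] S110 k A := hOne k A + (hTwo k A).toLinearMap
    have hgI : g (e.symm ⟨0, 1, 0, 0⟩) = 0 := hI
    have hgJ : g (e.symm ⟨0, 0, 1, 0⟩) = 0 := hJ
    have hgK : g (e.symm ⟨0, 0, 0, 1⟩) = 0 := hK
    have hg1 : g 1 = 1 + 1 := congrArg₂ (· + ·) h1 (map_one (hTwo k A))
    change g x ∈ _
    -- Only the real part survives: τ(x) + ρ(x) is the reduced trace 2 re(x).
    rw [hx, map_add, map_add, map_add, map_smul, map_smul, map_smul, map_smul, hgI, hgJ, hgK, hg1,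
      smul_zero, smul_zero, smul_zero, add_zero, add_zero, add_zero]
    exact Subalgebra.smul_mem _ (add_mem (one_mem _) (one_mem _)) _

end Quaternion

end SlA

theorem proposition6p11 {k : Type u} [Field k] [CharZero k] :
    (∀ (A : Type v) [Ring A] [Algebra k A], SlA.IsGeneralizedQuaternion k A →
      ∃ φ : A ≃ₐ[k] SlA.Seligman k A (r := 3) ![1, 1, 0],
        ∀ a : A, φ a = SlA.can k A ![1, 1, 0] (UniversalEnvelopingAlgebra.ι k (SlA.h k 1 a))) ∧
    (∀ n : ℕ, 2 ≤ n →
      Subsingleton (SlA.Seligman k (Matrix (Fin (2 * n)) (Fin (2 * n)) k) (r := 3) ![1, 1, 0])) := by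
  refine ⟨fun A _ _ ⟨a, b, ha, hb, ⟨e⟩⟩ => ⟨AlgEquiv.ofBijective (SlA.hTwo k A)
    (SlA.hTwo_bijective_of_quaternion ha hb e), fun _ => rfl⟩, fun n hn => ?_⟩
  -- Only three distinct indices are needed, and 2n ≥ 4 supplies them.
  exact SlA.subsingleton_of_matrix SlA.hOne_mul_hOne SlA.hOne_add_hTwo_mul_hTwo
    (i := ⟨0, by omega⟩) (j := ⟨1, by omega⟩) (l := ⟨2, by omega⟩) (by simp) (by simp) (by simp)
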